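/- Let $t\ge 2$ be an integer. For a partition $\lambda$ of a nonnegative integer, the $t$-quotient of $\lambda$ is the ordered $t$-tuple of partitions read off its abacus as follows: write $\lambda=(\lambda_1\ge\dots\ge\lambda_N\ge 0)$, padded with zeros, with $N$ a multiple of $t$ that is at least the number of parts; let $X=\{\lambda_i+N-i : 1\le i\le N\}$; for $0\le r<t$ the $r$-th entry is the partition whose nonzero parts are the nonzero values of $\#\{z\in\mathbb Z_{\ge0} : z<y,\ z\notin X_r\}$ for $y\in X_r:=\{x\ge 0 : tx+r\in X\}$, counted with multiplicity (the result does not depend on $N$). The $t$-core pre-tower of $\lambda$ has rows $\alpha_0,\alpha_1,\dots$, where $\alpha_0=(\lambda)$ and $\alpha_{k+1}$ is the list of the $t$-quotients, in order, of the partitions in $\alpha_k$. For $j\ge 0$, $\lambda$ is called a generalized $(j,t)$-core if all partitions in the row $\alpha_{j+1}$ are empty; let $c_{j,t}(n)$ be the number of generalized $(j,t)$-cores of size $n$. Write $(a;q)_\infty=\prod_{k\ge 0}(1-aq^k)$ and $(q)_\infty=(q;q)_\infty$. Then for every $j\ge0$, as formal power series in $q$, $$\sum_{n\ge 0}c_{j,t}(n)\,q^n=\frac{\left(q^{t^{j+1}};q^{t^{j+1}}\right)_\infty^{t^{j+1}}}{(q)_\infty}.$$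 Moreover, the generalized $(0,t)$-cores are exactly the $t$-cores, that is, the partitions whose Young diagram has no hook length divisible by $t$; hence the number $c_t(n)$ of $t$-cores of size $n$ satisfies $$\sum_{n\ge 0}c_t(n)\,q^n=\frac{\left(q^{t};q^{t}\right)_\infty^{t}}{(q)_\infty}.$$ -/

import Mathlib

namespace CoreTower

/-- An integer partition of arbitrary size; the first component of `⟨n, p⟩` is its size. -/
abbrev IntPartition : Type := Σ n : ℕ, n.Partition

/-- The parts of a partition in weakly decreasing order, indexed from `0` and continued by zeros. -/
def partAt {n : ℕ} (p : n.Partition) (i : ℕ) : ℕ :=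
  (p.parts.sort (· ≥ ·)).getD i 0

/-- The hook length of the cell `(i, j)` (row `i`, column `j`, both indexed from `0`) of the Young
diagram: the number of cells to its right, plus the number of cells below it, plus one. Only
meaningful for cells of the diagram, that is, for `j < partAt p i`. -/
def hookLength {n : ℕ} (p : n.Partition) (i j : ℕ) : ℕ :=
  (partAt p i - (j + 1)) +
    ((Finset.range p.parts.card).filter fun k => i < k ∧ j < partAt p k).card + 1

/-- A partition is a `t`-core if no hook length in its Young diagram is divisible by `t`. -/
def IsTCore (t : ℕ) {n : ℕ} (p : n.Partition) : Prop :=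
  ∀ i j : ℕ, j < partAt p i → ¬ t ∣ hookLength p i j

/-- The set of `N` beta-numbers (first column hook lengths after padding with zeros)
`λ_i + (N - i)`, `1 ≤ i ≤ N`, of a partition with at most `N` parts. -/
def betaSet {n : ℕ} (p : n.Partition) (N : ℕ) : Finset ℕ :=
  (Finset.range N).image fun i => partAt p i + (N - 1 - i)

/-- The partition with a given set of beta-numbers: each `y ∈ Y` contributes a part equal to the
number of gaps of `Y` below `y` (parts equal to zero are discarded). -/
def ofBetaSet (Y : Finset ℕ) : IntPartition :=
  ⟨_, Nat.Partition.ofMultiset (Y.val.map fun y => (Finset.range y \ Y).card)⟩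

/-- The positions of the beads on the `r`-th runner of the `t`-abacus of `X`:
those `x` with `t * x + r ∈ X`. -/
def runner (t r : ℕ) (X : Finset ℕ) : Finset ℕ :=
  (X.filter fun x => x % t = r).image fun x => x / t

/-- The `t`-quotient of a partition, an ordered list of `t` partitions. The partition is put on an
abacus with `t` runners, the number of beads being a multiple of `t` that is at least the number of
parts; the `r`-th entry is the partition whose beta-numbers are the positions on the
`r`-th runner. -/
def tQuotient (t : ℕ) (p : IntPartition) : List IntPartition :=
  (List.range t).map fun r => ofBetaSet (runner t r (betaSet p.2 (t * p.2.parts.card)))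

/-- The `j`-th row of the `t`-core pre-tower: row `0` consists of the partition itself, and row
`j + 1` of the `t`-quotients, in order, of the partitions in row `j`. -/
def preTowerRow (t : ℕ) (p : IntPartition) : ℕ → List IntPartition
  | 0 => [p]
  | j + 1 => (preTowerRow t p j).flatMap (tQuotient t)

/-- A generalized `(j, t)`-core: all partitions in row `j + 1` of the `t`-core pre-tower are
empty. -/
def IsGeneralizedCore (j t : ℕ) {n : ℕ} (p : n.Partition) : Prop :=
  ∀ μ ∈ preTowerRow t ⟨n, p⟩ (j + 1), μ.1 = 0

/-- The number of generalized `(j, t)`-cores of size `n`. -/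
noncomputable def numGeneralizedCores (j t n : ℕ) : ℕ :=
  Nat.card {p : n.Partition // IsGeneralizedCore j t p}

/-- The number of `t`-cores of size `n`. -/
noncomputable def numTCores (t n : ℕ) : ℕ :=
  Nat.card {p : n.Partition // IsTCore t p}

open scoped PowerSeries.WithPiTopology in
/-- The infinite product `(a; q)_∞ = ∏_{k ≥ 0} (1 - a q^k)` for formal power series, taken in the
topology of coefficientwise convergence. -/
noncomputable def qPochhammerInf (a q : PowerSeries ℚ) : PowerSeries ℚ :=
  ∏' k : ℕ, (1 - a * q ^ k)

open scoped PowerSeries.WithPiTopology in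
/-- The products `(q^m; q^m)_∞`, `m ≥ 1`, converge. -/
theorem multipliable_qPochhammerInf {m : ℕ} (hm : 1 ≤ m) :
    Multipliable fun k : ℕ =>
      (1 - (PowerSeries.X ^ m) * (PowerSeries.X ^ m) ^ k : PowerSeries ℚ) := by
  have h : ∀ k : ℕ, (1 - (PowerSeries.X ^ m) * (PowerSeries.X ^ m) ^ k : PowerSeries ℚ)
      = 1 + -(PowerSeries.X ^ (m * (k + 1))) := by
    intro k
    rw [← pow_succ', ← pow_mul, sub_eq_add_neg]
  simp_rw [h]
  apply PowerSeries.WithPiTopology.multipliable_one_add_of_tendsto_order_atTop_nhds_top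
  refine ENat.tendsto_nhds_top_iff_natCast_lt.mpr fun n => Filter.eventually_atTop.mpr ⟨n, ?_⟩
  intro k hk
  rw [PowerSeries.order_neg, PowerSeries.order_X_pow]
  exact_mod_cast (by nlinarith : n < m * (k + 1))

end CoreTower

/-! ### Partitions and their beta-sets -/

namespace CoreTower

open Finset

/-! Everything reduces to one condition on beads: `IsFlush s X`, no bead of `X` has a gap `s` places
before it. A partition is empty iff its beads are flush for `s = 1`, and beads are flush for `s * k`
iff every runner of the `s`-abacus is flush for `k`. Iterating, row `k` of the pre-tower is empty
iff the beads are flush for `t ^ k` (`preTowerRow_empty_iff`). The hook lengths of a row are the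
distances from its bead to the gaps before it, so the `t`-cores are the partitions flush for `t`
(`isTCore_iff_isFlush`).

It remains to count flush partitions for `s = t ^ (j + 1)` and `s = t`. A partition corresponds
bijectively to its `s`-core, a flush partition, together with its `s`-quotient, an arbitrary
`s`-tuple of partitions (`toCoreQuotient_injective`, `toCoreQuotient_surjective`), and its size is
|core| + s |quotient| (`toCoreQuotient_size`). Hence P(q) = C(q) P(q^s)^s for the generating
functions, and Euler's identity P(q) (q)_∞ = 1 gives C. -/

theorem IntPartition.ext_parts {p q : IntPartition} (h : p.2.parts = q.2.parts) : p = q := by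
  obtain ⟨n, p⟩ := p
  obtain ⟨m, q⟩ := q
  obtain rfl : n = m := by rw [← p.parts_sum, ← q.parts_sum]; exact congrArg _ h
  congr 1
  exact Nat.Partition.ext h

theorem partAt_eq_of_antitone {n : ℕ} (p : n.Partition) {f : ℕ → ℕ} (hf : Antitone f) {N : ℕ}
    (h0 : ∀ i, N ≤ i → f i = 0)
    (hp : p.parts = ((Multiset.range N).map f).filter (· ≠ 0)) (i : ℕ) : partAt p i = f i := by
  have hex : ∃ m, f m = 0 := ⟨N, h0 N le_rfl⟩
  obtain ⟨m, hm0, hmin⟩ : ∃ m, f m = 0 ∧ ∀ k < m, f k ≠ 0 :=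
    ⟨Nat.find hex, Nat.find_spec hex, fun k hk => Nat.find_min hex hk⟩
  have hz : ∀ k, m ≤ k → f k = 0 := fun k hk => by
    have := hf hk
    omega
  have hmN : m ≤ N := by
    by_contra h
    exact hmin N (by omega) (h0 N le_rfl)
  have h1 : p.parts = (Multiset.range m).map f := by
    rw [hp, Multiset.filter_map]
    congr 1
    refine (Multiset.Nodup.ext ((Multiset.nodup_range N).filter _) (Multiset.nodup_range m)).2 ?_
    intro a
    simp only [Multiset.mem_filter, Multiset.mem_range, Function.comp]
    constructor
    · rintro ⟨_, h⟩
      by_contra h'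
      exact h (hz a (by omega))
    · exact fun h => ⟨by omega, hmin a h⟩
  have h2 : p.parts.sort (· ≥ ·) = (List.range m).map f := by
    refine List.Perm.eq_of_pairwise' (r := (· ≥ ·)) (Multiset.pairwise_sort _ _) ?_ ?_
    · rw [List.pairwise_map]
      exact (List.pairwise_lt_range).imp fun h => hf h.le
    · rw [← Multiset.coe_eq_coe, Multiset.sort_eq, h1]
      rfl
  rw [partAt, h2]
  by_cases him : i < m
  · simp [List.getD, him]
  · rw [hz i (by omega)]
    simp [List.getD, him]

section partAt

variable {n : ℕ} (p : n.Partition)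

theorem partAt_eq_zero {i : ℕ} (h : p.parts.card ≤ i) : partAt p i = 0 := by
  rw [partAt, List.getD_eq_default]
  simpa using h

theorem partAt_pos {i : ℕ} (h : i < p.parts.card) : 0 < partAt p i := by
  have h' : i < (p.parts.sort (· ≥ ·)).length := by simpa using h
  rw [partAt, List.getD_eq_getElem _ _ h']
  apply p.parts_pos
  rw [← Multiset.mem_sort (r := (· ≥ ·))]
  exact List.getElem_mem h'

theorem partAt_antitone : Antitone (partAt p) := by
  intro i j hij
  by_cases hj : j < p.parts.card
  · have hj' : j < (p.parts.sort (· ≥ ·)).length := by simpa using hj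
    have hi' : i < (p.parts.sort (· ≥ ·)).length := by omega
    rw [partAt, partAt, List.getD_eq_getElem _ _ hj', List.getD_eq_getElem _ _ hi']
    rcases hij.eq_or_lt with rfl | h
    · exact le_rfl
    · exact List.pairwise_iff_getElem.1 (Multiset.pairwise_sort p.parts (· ≥ ·)) i j hi' hj' h
  · rw [partAt_eq_zero p (by omega)]
    exact Nat.zero_le _

theorem map_partAt_range_card : (Multiset.range p.parts.card).map (partAt p) = p.parts := by
  conv_rhs => rw [← Multiset.sort_eq p.parts (· ≥ ·)]
  change ((List.range p.parts.card).map (partAt p) : Multiset ℕ) = _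
  congr 1
  refine List.ext_getElem (by simp) ?_
  intro i h1 h2
  simp only [List.getElem_map, List.getElem_range]
  rw [partAt, List.getD_eq_getElem _ _ h2]

theorem filter_map_partAt {N : ℕ} (hN : p.parts.card ≤ N) :
    ((Multiset.range N).map (partAt p)).filter (· ≠ 0) = p.parts := by
  conv_rhs => rw [← map_partAt_range_card]
  rw [Multiset.filter_map]
  congr 1
  refine (Multiset.Nodup.ext ((Multiset.nodup_range N).filter _) (Multiset.nodup_range _)).2 ?_
  intro a
  simp only [Multiset.mem_filter, Multiset.mem_range, Function.comp]
  constructor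
  · rintro ⟨_, h⟩
    by_contra h'
    exact h (partAt_eq_zero p (by omega))
  · exact fun h => ⟨by omega, (partAt_pos p h).ne'⟩

theorem sum_partAt {N : ℕ} (hN : p.parts.card ≤ N) : ∑ i ∈ range N, partAt p i = n := by
  conv_rhs => rw [← p.parts_sum, ← map_partAt_range_card]
  change _ = ∑ i ∈ range p.parts.card, partAt p i
  symm
  apply sum_subset (range_subset_range.2 hN)
  intro i _ hi
  exact partAt_eq_zero p (by simpa using hi)

theorem mem_betaSet {N x : ℕ} :
    x ∈ betaSet p N ↔ ∃ i < N, partAt p i + (N - 1 - i) = x := by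
  simp [betaSet]

theorem beta_lt_beta {N i k : ℕ} (hik : i < k) (hk : k < N) :
    partAt p k + (N - 1 - k) < partAt p i + (N - 1 - i) := by
  have := partAt_antitone p hik.le
  omega

theorem beta_lt_beta_iff {N i k : ℕ} (hi : i < N) (hk : k < N) :
    partAt p k + (N - 1 - k) < partAt p i + (N - 1 - i) ↔ i < k := by
  refine ⟨fun h => ?_, fun h => beta_lt_beta p h hk⟩
  by_contra h'
  rcases (not_lt.1 h').eq_or_lt with rfl | h''
  · omega
  · have := beta_lt_beta p h'' hi
    omega

theorem beta_injOn (N : ℕ) :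
    Set.InjOn (fun i => partAt p i + (N - 1 - i)) (range N : Set ℕ) := by
  intro i hi k hk h
  simp only [coe_range, Set.mem_Iio] at hi hk
  have h1 := (beta_lt_beta_iff p hi hk).not
  have h2 := (beta_lt_beta_iff p hk hi).not
  simp only at h
  omega

theorem card_betaSet (N : ℕ) : (betaSet p N).card = N := by
  rw [betaSet, card_image_of_injOn (beta_injOn p N), card_range]

/-- The beads below the `i`-th one are exactly those of index `k > i`, which are `N - 1 - i` in
number; the other `partAt p i` positions are gaps. -/
theorem card_gaps_betaSet {N i : ℕ} (hi : i < N) :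
    (range (partAt p i + (N - 1 - i)) \ betaSet p N).card = partAt p i := by
  have h : range (partAt p i + (N - 1 - i)) ∩ betaSet p N =
      (Ioo i N).image fun k => partAt p k + (N - 1 - k) := by
    ext x
    simp only [mem_inter, mem_range, mem_betaSet, mem_image, mem_Ioo]
    constructor
    · rintro ⟨h1, k, hk, rfl⟩
      exact ⟨k, ⟨(beta_lt_beta_iff p hi hk).1 h1, hk⟩, rfl⟩
    · rintro ⟨k, ⟨h1, h2⟩, rfl⟩
      exact ⟨beta_lt_beta p h1 h2, k, h2, rfl⟩
  have hc := card_sdiff_add_card_inter (range (partAt p i + (N - 1 - i))) (betaSet p N)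
  rw [h, card_image_of_injOn, Nat.card_Ioo, card_range] at hc
  · omega
  · exact (beta_injOn p N).mono fun k hk => by
      simp only [coe_Ioo, Set.mem_Ioo] at hk
      simpa using hk.2

end partAt

theorem ofBetaSet_parts (Y : Finset ℕ) :
    (ofBetaSet Y).2.parts = (Y.val.map fun y => (range y \ Y).card).filter (· ≠ 0) := rfl

theorem ofBetaSet_size (Y : Finset ℕ) : (ofBetaSet Y).1 = ∑ y ∈ Y, (range y \ Y).card := rfl

theorem card_parts_ofBetaSet_le (Y : Finset ℕ) : (ofBetaSet Y).2.parts.card ≤ Y.card := by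
  rw [ofBetaSet_parts]
  exact (Multiset.card_le_card (Multiset.filter_le _ _)).trans (by simp)

theorem ofBetaSet_betaSet (p : IntPartition) {N : ℕ} (hN : p.2.parts.card ≤ N) :
    ofBetaSet (betaSet p.2 N) = p := by
  apply IntPartition.ext_parts
  rw [ofBetaSet_parts]
  conv_rhs => rw [← filter_map_partAt p.2 hN]
  congr 1
  rw [betaSet, image_val_of_injOn (beta_injOn p.2 N), Multiset.map_map]
  apply Multiset.map_congr rfl
  intro i hi
  exact card_gaps_betaSet p.2 (by simpa using hi)

theorem exists_betaSet_eq (Y : Finset ℕ) :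
    ∃ p : IntPartition, p.2.parts.card ≤ Y.card ∧ betaSet p.2 Y.card = Y := by
  set N := Y.card with hNdef
  let e := Y.orderEmbOfFin hNdef.symm
  let y : ℕ → ℕ := fun i => if h : i < N then e ⟨N - 1 - i, by omega⟩ else 0
  have hy : ∀ i (h : i < N), y i = e ⟨N - 1 - i, by omega⟩ := fun i h => dif_pos h
  have hlt : ∀ i k, i < k → k < N → y k < y i := by
    intro i k hik hk
    rw [hy i (by omega), hy k hk]
    apply e.strictMono
    simp only [Fin.mk_lt_mk]
    omega
  let f : ℕ → ℕ := fun i => y i - (N - 1 - i)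
  have hf0 : ∀ i, N ≤ i → f i = 0 := fun i hi => by
    have : y i = 0 := dif_neg (by omega)
    simp [f, this]
  have hf : Antitone f := by
    refine antitone_nat_of_succ_le fun i => ?_
    by_cases h : i + 1 < N
    · have := hlt i (i + 1) (by omega) h
      simp only [f]
      omega
    · rw [hf0 (i + 1) (by omega)]
      exact Nat.zero_le _
  -- At least `N - 1 - i` beads lie below `y i`, so the subtraction in `f` is never truncated.
  have hge : ∀ d i, i + d + 1 = N → d ≤ y i := by
    intro d
    induction d with
    | zero => intro i _; exact Nat.zero_le _
    | succ d ih =>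
      intro i hi
      have h1 := ih (i + 1) (by omega)
      have h2 := hlt i (i + 1) (by omega) (by omega)
      omega
  let p : IntPartition := ⟨_, Nat.Partition.ofMultiset ((Multiset.range N).map f)⟩
  have hp : p.2.parts = ((Multiset.range N).map f).filter (· ≠ 0) := rfl
  refine ⟨p, ?_, ?_⟩
  · rw [hp]
    exact (Multiset.card_le_card (Multiset.filter_le _ _)).trans (by simp)
  · ext x
    rw [mem_betaSet]
    simp only [partAt_eq_of_antitone p.2 hf hf0 hp]
    have hfy : ∀ i < N, f i + (N - 1 - i) = y i := fun i hi => by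
      have := hge (N - 1 - i) i (by omega)
      simp only [f]
      omega
    have hr : Set.range e = (Y : Set ℕ) := Finset.range_orderEmbOfFin Y _
    rw [← Finset.mem_coe, ← hr]
    constructor
    · rintro ⟨i, hi, rfl⟩
      rw [hfy i hi, hy i hi]
      exact Set.mem_range_self _
    · rintro ⟨k, rfl⟩
      have hk := k.2
      refine ⟨N - 1 - k, by omega, ?_⟩
      rw [hfy _ (by omega), hy _ (by omega)]
      congr 1
      ext
      simp only
      omega

theorem betaSet_ofBetaSet (Y : Finset ℕ) : betaSet (ofBetaSet Y).2 Y.card = Y := by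
  obtain ⟨p, hp, h⟩ := exists_betaSet_eq Y
  have h' := ofBetaSet_betaSet p hp
  rw [h] at h'
  rw [h', h]

theorem ofBetaSet_injective_of_card {Y Z : Finset ℕ} (hc : Y.card = Z.card)
    (h : ofBetaSet Y = ofBetaSet Z) : Y = Z := by
  rw [← betaSet_ofBetaSet Y, ← betaSet_ofBetaSet Z, h, hc]

/-- For a fixed number of beads, size is the sum of the bead positions up to a constant. -/
theorem ofBetaSet_size_add (Y : Finset ℕ) :
    (ofBetaSet Y).1 + ∑ i ∈ range Y.card, i = ∑ y ∈ Y, y := by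
  conv_rhs => rw [← betaSet_ofBetaSet Y]
  rw [betaSet, sum_image (beta_injOn _ _), sum_add_distrib,
    sum_partAt _ (card_parts_ofBetaSet_le Y), sum_range_reflect (fun i => i)]

/-- Adding a bead to the left of all positions and moving the other beads one step up. -/
def bump (Y : Finset ℕ) : Finset ℕ := insert 0 (Y.image (· + 1))

theorem zero_mem_bump (Y : Finset ℕ) : 0 ∈ bump Y := by simp [bump]

theorem succ_mem_bump {Y : Finset ℕ} {x : ℕ} : x + 1 ∈ bump Y ↔ x ∈ Y := by simp [bump]

theorem card_bump (Y : Finset ℕ) : (bump Y).card = Y.card + 1 := by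
  rw [bump, card_insert_of_notMem (by simp), card_image_of_injective _ (add_left_injective 1)]

theorem betaSet_succ {n : ℕ} (p : n.Partition) {N : ℕ} (hN : p.parts.card ≤ N) :
    betaSet p (N + 1) = bump (betaSet p N) := by
  ext x
  rcases x with _ | x
  · simp only [zero_mem_bump, iff_true, mem_betaSet]
    exact ⟨N, by omega, by rw [partAt_eq_zero p hN]; omega⟩
  · rw [succ_mem_bump, mem_betaSet, mem_betaSet]
    constructor
    · rintro ⟨i, hi, h⟩
      have hiN : i ≠ N := by
        rintro rfl
        rw [partAt_eq_zero p hN] at h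
        omega
      exact ⟨i, by omega, by omega⟩
    · rintro ⟨i, hi, h⟩
      exact ⟨i, by omega, by omega⟩

theorem mem_betaSet_add {n : ℕ} (p : n.Partition) {N : ℕ} (hN : p.parts.card ≤ N) (k x : ℕ) :
    x ∈ betaSet p (N + k) ↔ x < k ∨ k ≤ x ∧ x - k ∈ betaSet p N := by
  induction k generalizing x with
  | zero => simp
  | succ k ih =>
    rw [← add_assoc, betaSet_succ p (by omega)]
    rcases x with _ | x
    · simp [zero_mem_bump]
    · rw [succ_mem_bump, ih]
      simp

theorem ofBetaSet_bump (Y : Finset ℕ) : ofBetaSet (bump Y) = ofBetaSet Y := by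
  have h := card_parts_ofBetaSet_le Y
  rw [← ofBetaSet_betaSet (ofBetaSet Y) (N := Y.card + 1) (by omega), betaSet_succ _ h,
    betaSet_ofBetaSet]

end CoreTower

/-! ### Flush bead configurations and the pre-tower -/

namespace CoreTower

open Finset

/-- All beads of `X` are pushed up as far as possible on the `s`-abacus. -/
def IsFlush (s : ℕ) (X : Finset ℕ) : Prop := ∀ x, x + s ∈ X → x ∈ X

theorem isFlush_bump {s : ℕ} {X : Finset ℕ} : IsFlush s (bump X) ↔ IsFlush s X := by
  constructor
  · intro h x hx
    have := h (x + 1) (by rw [show x + 1 + s = x + s + 1 by ring, succ_mem_bump]; exact hx)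
    rwa [succ_mem_bump] at this
  · rintro h (_ | x) hx
    · exact zero_mem_bump X
    · rw [show x + 1 + s = x + s + 1 by ring, succ_mem_bump] at hx
      exact succ_mem_bump.2 (h x hx)

theorem IsFlush.mem_of_add_mul {s : ℕ} {X : Finset ℕ} (h : IsFlush s X) {x : ℕ} (m : ℕ)
    (hx : x + s * m ∈ X) : x ∈ X := by
  induction m with
  | zero => simpa using hx
  | succ m ih => exact ih (h _ (by rwa [show x + s * m + s = x + s * (m + 1) by ring]))

theorem isFlush_betaSet_iff {s n : ℕ} (p : n.Partition) {N : ℕ}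
    (hN : p.parts.card ≤ N) : IsFlush s (betaSet p N) ↔ IsFlush s (betaSet p p.parts.card) := by
  induction N, hN using Nat.le_induction with
  | base => rfl
  | succ N hN ih => rw [betaSet_succ p hN, isFlush_bump, ih]

theorem IsFlush.eq_range {X : Finset ℕ} (h : IsFlush 1 X) : X = range X.card := by
  have hsub : ∀ y ∈ X, range (y + 1) ⊆ X := by
    intro y hy x hx
    rw [mem_range] at hx
    apply h.mem_of_add_mul (y - x)
    rwa [show x + 1 * (y - x) = y by omega]
  refine eq_of_subset_of_card_le (fun y hy => ?_) (by simp)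
  have := card_le_card (hsub y hy)
  rw [card_range] at this
  exact mem_range.2 (by omega)

theorem ofBetaSet_size_eq_zero_iff {Y : Finset ℕ} : (ofBetaSet Y).1 = 0 ↔ IsFlush 1 Y := by
  rw [ofBetaSet_size, sum_eq_zero_iff]
  simp only [card_eq_zero, sdiff_eq_empty_iff_subset]
  constructor
  · exact fun h x hx => h _ hx (by simp)
  · intro h y hy x hx
    rw [mem_range] at hx
    apply h.mem_of_add_mul (y - x)
    rwa [show x + 1 * (y - x) = y by omega]

theorem mem_runner {s r : ℕ} (hr : r < s) {X : Finset ℕ} {x : ℕ} :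
    x ∈ runner s r X ↔ s * x + r ∈ X := by
  simp only [runner, mem_image, mem_filter]
  constructor
  · rintro ⟨y, ⟨hy, rfl⟩, rfl⟩
    rwa [Nat.div_add_mod]
  · intro h
    refine ⟨s * x + r, ⟨h, ?_⟩, ?_⟩
    · rw [Nat.mul_add_mod, Nat.mod_eq_of_lt hr]
    · rw [Nat.mul_add_div (by omega), Nat.div_eq_of_lt hr, add_zero]

/-- A move by `s * k` places stays on its runner of the `s`-abacus and is a move by `k` places
there. -/
theorem isFlush_mul_iff {s k : ℕ} (hs : 0 < s) {X : Finset ℕ} :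
    IsFlush (s * k) X ↔ ∀ r < s, IsFlush k (runner s r X) := by
  constructor
  · intro h r hr x hx
    rw [mem_runner hr] at hx ⊢
    exact h _ (by rwa [show s * x + r + s * k = s * (x + k) + r by ring])
  · intro h x hx
    have hr := Nat.mod_lt x hs
    have := h (x % s) hr (x / s) (by
      rw [mem_runner hr]
      rwa [show s * (x / s + k) + x % s = s * (x / s) + x % s + s * k by ring, Nat.div_add_mod])
    rwa [mem_runner hr, Nat.div_add_mod] at this

/-- Peels off the first quotient instead of the last, so that an induction on the row can vary the
partition. -/
theorem preTowerRow_succ' (t : ℕ) (p : IntPartition) (j : ℕ) :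
    preTowerRow t p (j + 1) = (tQuotient t p).flatMap fun q => preTowerRow t q j := by
  induction j with
  | zero => simp [preTowerRow]
  | succ j ih =>
    rw [preTowerRow, ih, List.flatMap_assoc]
    rfl

theorem preTowerRow_empty_iff {t : ℕ} (ht : 0 < t) (k : ℕ) (p : IntPartition) :
    (∀ μ ∈ preTowerRow t p k, μ.1 = 0) ↔ IsFlush (t ^ k) (betaSet p.2 p.2.parts.card) := by
  induction k generalizing p with
  | zero =>
    rw [pow_zero, ← ofBetaSet_size_eq_zero_iff, ofBetaSet_betaSet p le_rfl]
    simp [preTowerRow]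
  | succ k ih =>
    rw [preTowerRow_succ', pow_succ', ← isFlush_betaSet_iff p.2
      (Nat.le_mul_of_pos_left _ ht), isFlush_mul_iff ht]
    simp only [List.mem_flatMap, tQuotient, List.mem_map, List.mem_range]
    constructor
    · intro h r hr
      set Y := runner t r (betaSet p.2 (t * p.2.parts.card))
      have h1 := (ih (ofBetaSet Y)).1 fun μ hμ => h μ ⟨_, ⟨r, hr, rfl⟩, hμ⟩
      rwa [← isFlush_betaSet_iff _ (card_parts_ofBetaSet_le Y),
        betaSet_ofBetaSet] at h1
    · rintro h μ ⟨_, ⟨r, hr, rfl⟩, hμ⟩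
      refine (ih _).2 ?_ μ hμ
      rw [← isFlush_betaSet_iff _ (card_parts_ofBetaSet_le _), betaSet_ofBetaSet]
      exact h r hr

/-! ### Hook lengths as distances from beads to gaps -/

section hook

variable {n : ℕ} (p : n.Partition)

/-- The parts of the conjugate partition. -/
def conjPart (j : ℕ) : ℕ := ((range p.parts.card).filter fun k => j < partAt p k).card

theorem lt_conjPart_iff {j k : ℕ} : k < conjPart p j ↔ j < partAt p k := by
  have hex : ∃ c, partAt p c ≤ j := ⟨p.parts.card, by rw [partAt_eq_zero p le_rfl]; omega⟩
  obtain ⟨c, hc, hmin⟩ : ∃ c, partAt p c ≤ j ∧ ∀ k < c, j < partAt p k :=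
    ⟨Nat.find hex, Nat.find_spec hex, fun k hk => not_le.1 (Nat.find_min hex hk)⟩
  have h : ∀ k, j < partAt p k ↔ k < c := fun k => by
    refine ⟨fun hk => ?_, hmin k⟩
    by_contra h'
    have := partAt_antitone p (not_lt.1 h')
    omega
  have h2 : (range p.parts.card).filter (fun k => j < partAt p k) = range c := by
    ext k
    rw [mem_filter, mem_range, mem_range, h]
    refine ⟨fun h => h.2, fun hk => ⟨?_, hk⟩⟩
    by_contra h'
    have h3 := hmin k hk
    rw [partAt_eq_zero p (by omega)] at h3
    omega
  rw [conjPart, h2, card_range, h]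

theorem conjPart_le (j : ℕ) : conjPart p j ≤ p.parts.card :=
  (card_filter_le _ _).trans (by simp)

theorem conjPart_antitone : Antitone (conjPart p) := by
  intro j j' h
  by_contra h'
  have h1 := (lt_conjPart_iff p).1 (not_le.1 h')
  have h2 := (lt_conjPart_iff p (j := j) (k := conjPart p j)).2 (by omega)
  omega

/-- Column `j` determines a position `card + j - conjPart p j`, independent of the row;
`gap_notMem_betaSet` shows that it is a gap. -/
theorem hookLength_add {i j : ℕ} (hj : j < partAt p i) :
    hookLength p i j + (p.parts.card + j - conjPart p j) =
      partAt p i + (p.parts.card - 1 - i) := by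
  have h : (range p.parts.card).filter (fun k => i < k ∧ j < partAt p k) =
      Ioo i (conjPart p j) := by
    ext k
    have := conjPart_le p j
    simp only [mem_filter, mem_range, mem_Ioo, ← lt_conjPart_iff]
    omega
  have h1 := (lt_conjPart_iff p).2 hj
  have h2 := conjPart_le p j
  rw [hookLength, h, Nat.card_Ioo]
  omega

theorem gap_notMem_betaSet (j : ℕ) :
    p.parts.card + j - conjPart p j ∉ betaSet p p.parts.card := by
  rw [mem_betaSet]
  rintro ⟨i, hi, h⟩
  -- Equality would force λ_i + λ'_j = i + j + 1, but the sum is at least i + j + 2 if the cell (i,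
  -- j) is in the diagram and at most i + j otherwise.
  have h1 := lt_conjPart_iff p (j := j) (k := i)
  have h2 := conjPart_le p j
  omega

/-- By counting: the columns `j < partAt p i` give distinct gaps below the bead, as many as there
are. -/
theorem exists_gap_eq {i z : ℕ} (hi : i < p.parts.card)
    (hz : z < partAt p i + (p.parts.card - 1 - i)) (hzX : z ∉ betaSet p p.parts.card) :
    ∃ j < partAt p i, p.parts.card + j - conjPart p j = z := by
  have hinj : StrictMono fun j => p.parts.card + j - conjPart p j := by
    refine strictMono_nat_of_lt_succ fun j => ?_
    have h1 := conjPart_le p j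
    have h2 := conjPart_antitone p (Nat.le_succ j)
    simp only [Nat.succ_eq_add_one] at h2
    omega
  have h : (range (partAt p i)).image (fun j => p.parts.card + j - conjPart p j) =
      range (partAt p i + (p.parts.card - 1 - i)) \ betaSet p p.parts.card := by
    apply eq_of_subset_of_card_le
    · intro y hy
      simp only [mem_image, mem_range] at hy
      obtain ⟨j, hj, rfl⟩ := hy
      have h1 := hookLength_add p hj
      have h2 : 0 < hookLength p i j := Nat.succ_pos _
      rw [mem_sdiff, mem_range]
      exact ⟨by omega, gap_notMem_betaSet p j⟩
    · rw [card_gaps_betaSet p hi, card_image_of_injective _ hinj.injective, card_range]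
  have hz' : z ∈ range (partAt p i + (p.parts.card - 1 - i)) \ betaSet p p.parts.card :=
    mem_sdiff.2 ⟨mem_range.2 hz, hzX⟩
  rw [← h] at hz'
  simpa using hz'

theorem isTCore_iff_isFlush {t : ℕ} (ht : 0 < t) :
    IsTCore t p ↔ IsFlush t (betaSet p p.parts.card) := by
  constructor
  · intro h x hx
    by_contra hxX
    obtain ⟨i, hi, hix⟩ := (mem_betaSet p).1 hx
    obtain ⟨j, hj, hjx⟩ := exists_gap_eq p hi (z := x) (by omega) hxX
    have := hookLength_add p hj
    apply h i j hj
    rw [show hookLength p i j = t by omega]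
  · rintro h i j hj ⟨m, hm⟩
    have h1 := hookLength_add p hj
    have hi : i < p.parts.card := ((lt_conjPart_iff p).2 hj).trans_le (conjPart_le p j)
    apply gap_notMem_betaSet p j
    apply h.mem_of_add_mul m
    rw [← hm, mem_betaSet]
    exact ⟨i, hi, by omega⟩

end hook

theorem isGeneralizedCore_iff_isFlush {t : ℕ} (ht : 0 < t) (j : ℕ) {n : ℕ} (p : n.Partition) :
    IsGeneralizedCore j t p ↔ IsFlush (t ^ (j + 1)) (betaSet p p.parts.card) :=
  preTowerRow_empty_iff ht (j + 1) ⟨n, p⟩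

end CoreTower

/-! ### Runners and pushing beads up -/

namespace CoreTower

open Finset

variable {s : ℕ}

/-- The bead configuration with prescribed runners. -/
def ofRunners (Y : Fin s → Finset ℕ) : Finset ℕ :=
  univ.biUnion fun r => (Y r).image fun x => s * x + r

theorem runner_ext {X Z : Finset ℕ} (hs : 0 < s)
    (h : ∀ r : Fin s, runner s r X = runner s r Z) : X = Z := by
  ext x
  have := congrArg (x / s ∈ ·) (h ⟨x % s, Nat.mod_lt x hs⟩)
  simpa only [mem_runner (Nat.mod_lt x hs), Nat.div_add_mod, eq_iff_iff] using this

theorem runner_ofRunners (Y : Fin s → Finset ℕ) (r : Fin s) : runner s r (ofRunners Y) = Y r := by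
  ext x
  rw [mem_runner r.2]
  simp only [ofRunners, mem_biUnion, mem_univ, true_and, mem_image]
  constructor
  · rintro ⟨r', y, hy, h⟩
    have hs : 0 < s := r.pos
    have h1 := congrArg (· % s) h
    have h2 := congrArg (· / s) h
    simp only [Nat.mul_add_mod, Nat.mod_eq_of_lt r.2, Nat.mod_eq_of_lt r'.2] at h1
    simp only [Nat.mul_add_div hs, Nat.div_eq_of_lt r.2, Nat.div_eq_of_lt r'.2, add_zero] at h2
    obtain rfl := Fin.ext h1
    rwa [← h2]
  · exact fun h => ⟨r, x, h, rfl⟩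

theorem sum_eq_sum_runner (hs : 0 < s) (X : Finset ℕ) (f : ℕ → ℕ) :
    ∑ x ∈ X, f x = ∑ r : Fin s, ∑ y ∈ runner s r X, f (s * y + r) := by
  rw [← sum_fiberwise X (fun x => (⟨x % s, Nat.mod_lt x hs⟩ : Fin s))]
  refine sum_congr rfl fun r _ => ?_
  rw [runner, sum_image]
  · have : (X.filter fun x => (⟨x % s, Nat.mod_lt x hs⟩ : Fin s) = r) =
        X.filter fun x => x % s = r := by
      ext x
      simp [Fin.ext_iff]
    rw [this]
    refine sum_congr rfl fun x hx => ?_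
    rw [← (mem_filter.1 hx).2, Nat.div_add_mod]
  · intro x hx y hy h
    simp only [coe_filter, Set.mem_ofPred_eq] at hx hy
    simp only at h
    rw [← Nat.div_add_mod x s, ← Nat.div_add_mod y s, hx.2, hy.2, h]

theorem card_eq_sum_card_runner (hs : 0 < s) (X : Finset ℕ) :
    X.card = ∑ r : Fin s, (runner s r X).card := by
  simpa only [card_eq_sum_ones] using sum_eq_sum_runner hs X fun _ => 1

theorem sum_eq_sum_card_runner (hs : 0 < s) (X : Finset ℕ) :
    ∑ x ∈ X, x = s * ∑ r : Fin s, ∑ y ∈ runner s r X, y +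
      ∑ r : Fin s, (runner s r X).card * (r : ℕ) := by
  rw [sum_eq_sum_runner hs, mul_sum, ← sum_add_distrib]
  refine sum_congr rfl fun r _ => ?_
  rw [sum_add_distrib, sum_const, smul_eq_mul, mul_sum]

/-- The configuration obtained by pushing all beads of the `s`-abacus up. -/
def flush (s : ℕ) (X : Finset ℕ) : Finset ℕ :=
  ofRunners fun r : Fin s => range (runner s r X).card

theorem runner_flush (X : Finset ℕ) (r : Fin s) :
    runner s r (flush s X) = range (runner s r X).card := runner_ofRunners _ r

theorem card_flush (hs : 0 < s) (X : Finset ℕ) : (flush s X).card = X.card := by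
  rw [card_eq_sum_card_runner hs, card_eq_sum_card_runner hs X]
  simp only [runner_flush, card_range]

theorem isFlush_iff_runner (hs : 0 < s) {X : Finset ℕ} :
    IsFlush s X ↔ ∀ r : Fin s, IsFlush 1 (runner s r X) := by
  have h := isFlush_mul_iff (k := 1) hs (X := X)
  rw [mul_one] at h
  exact h.trans ⟨fun h r => h r r.2, fun h r hr => h ⟨r, hr⟩⟩

theorem isFlush_flush (hs : 0 < s) (X : Finset ℕ) : IsFlush s (flush s X) := by
  rw [isFlush_iff_runner hs]
  intro r x
  rw [runner_flush, mem_range, mem_range]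
  omega

theorem flush_congr {X Z : Finset ℕ}
    (h : ∀ r : Fin s, (runner s r X).card = (runner s r Z).card) : flush s X = flush s Z := by
  simp only [flush, h]

theorem IsFlush.flush_eq (hs : 0 < s) {X : Finset ℕ} (h : IsFlush s X) : flush s X = X := by
  refine runner_ext hs fun r => ?_
  rw [runner_flush]
  exact ((isFlush_iff_runner hs).1 h r).eq_range.symm

theorem runner_betaSet_add {n : ℕ} (p : n.Partition) {N : ℕ} (hN : p.parts.card ≤ N)
    (r : Fin s) : runner s r (betaSet p (N + s)) = bump (runner s r (betaSet p N)) := by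
  have hr := r.2
  ext x
  rw [mem_runner hr, mem_betaSet_add p hN]
  rcases x with _ | x
  · simp [zero_mem_bump]
  · rw [succ_mem_bump, mem_runner hr, show s * (x + 1) + r = s * x + r + s by ring]
    simp

theorem bump_range (n : ℕ) : bump (range n) = range (n + 1) := by
  ext x
  rcases x with _ | x
  · simp [zero_mem_bump]
  · simp [succ_mem_bump]

theorem betaSet_ofBetaSet_flush_add (hs : 0 < s) {n : ℕ} (p : n.Partition) {N : ℕ}
    (hN : p.parts.card ≤ N) :
    betaSet (ofBetaSet (flush s (betaSet p N))).2 (N + s) = flush s (betaSet p (N + s)) := by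
  have hc : (flush s (betaSet p N)).card = N := by rw [card_flush hs, card_betaSet]
  have hle := card_parts_ofBetaSet_le (flush s (betaSet p N))
  have hb := betaSet_ofBetaSet (flush s (betaSet p N))
  rw [hc] at hle hb
  refine runner_ext hs fun r => ?_
  rw [runner_betaSet_add _ hle, hb, runner_flush, runner_flush, bump_range,
    runner_betaSet_add p hN, card_bump]

/-! ### The bijection between partitions and pairs (core, quotient) -/

/-- The `s`-core and the `s`-quotient of the partition with beta-numbers `X`. -/
def coreQuotient (s : ℕ) (X : Finset ℕ) : IntPartition × (Fin s → IntPartition) :=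
  (ofBetaSet (flush s X), fun r => ofBetaSet (runner s r X))

theorem coreQuotient_betaSet_add (hs : 0 < s) {n : ℕ} (p : n.Partition) {N : ℕ}
    (hN : p.parts.card ≤ N) :
    coreQuotient s (betaSet p (N + s)) = coreQuotient s (betaSet p N) := by
  refine Prod.ext ?_ (funext fun r => ?_)
  · have hle := card_parts_ofBetaSet_le (flush s (betaSet p N))
    rw [card_flush hs, card_betaSet] at hle
    rw [coreQuotient, ← betaSet_ofBetaSet_flush_add hs p hN, ofBetaSet_betaSet _ (by omega)]
    rfl
  · simp only [coreQuotient]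
    rw [runner_betaSet_add p hN, ofBetaSet_bump]

theorem coreQuotient_betaSet_mul (hs : 0 < s) {n : ℕ} (p : n.Partition) {M : ℕ}
    (hM : p.parts.card ≤ s * M) (k : ℕ) :
    coreQuotient s (betaSet p (s * (M + k))) = coreQuotient s (betaSet p (s * M)) := by
  induction k with
  | zero => rfl
  | succ k ih =>
    rw [← add_assoc, mul_add_one, coreQuotient_betaSet_add hs p (by nlinarith), ih]

/-- Both bead numbers are compared with their sum: `s` further beads merely bump every runner. -/
theorem coreQuotient_betaSet_eq (hs : 0 < s) {n : ℕ} (p : n.Partition) {M : ℕ}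
    (hM : p.parts.card ≤ s * M) :
    coreQuotient s (betaSet p (s * p.parts.card)) = coreQuotient s (betaSet p (s * M)) := by
  rw [← coreQuotient_betaSet_mul hs p hM p.parts.card, add_comm M,
    coreQuotient_betaSet_mul hs p (Nat.le_mul_of_pos_left _ hs)]

/-- The core recovers the number of beads on each runner; with that number, the quotient recovers
the runner. -/
theorem coreQuotient_injective (hs : 0 < s) {X Z : Finset ℕ} (hc : X.card = Z.card)
    (h : coreQuotient s X = coreQuotient s Z) : X = Z := by
  have h1 : flush s X = flush s Z := by
    apply ofBetaSet_injective_of_card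
    · rw [card_flush hs, card_flush hs, hc]
    · exact congrArg Prod.fst h
  refine runner_ext hs fun r => ofBetaSet_injective_of_card ?_ (congrFun (congrArg Prod.snd h) r)
  have := congrArg (fun W => (runner s r W).card) h1
  simpa only [runner_flush, card_range] using this

/-- `X` and `flush s X` have equally many beads on each runner, and one step along a runner changes
the bead sum by `s`. -/
theorem coreQuotient_size (hs : 0 < s) (X : Finset ℕ) :
    (coreQuotient s X).1.1 + s * ∑ r, ((coreQuotient s X).2 r).1 = (ofBetaSet X).1 := by
  have h1 := ofBetaSet_size_add X
  have h2 := ofBetaSet_size_add (flush s X)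
  rw [sum_eq_sum_card_runner hs X] at h1
  rw [sum_eq_sum_card_runner hs (flush s X)] at h2
  rw [card_flush hs] at h2
  simp only [runner_flush, card_range] at h2
  have h3 : ∑ r : Fin s, ∑ y ∈ runner s r X, y = ∑ r : Fin s, (ofBetaSet (runner s r X)).1 +
      ∑ r : Fin s, ∑ i ∈ range (runner s r X).card, i := by
    rw [← sum_add_distrib]
    exact sum_congr rfl fun r _ => (ofBetaSet_size_add _).symm
  rw [h3, mul_add] at h1
  simp only [coreQuotient]
  omega

/-- The partitions all of whose beads are pushed up on the `s`-abacus. -/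
abbrev FlushPartition (s : ℕ) : Type :=
  {p : IntPartition // IsFlush s (betaSet p.2 p.2.parts.card)}

/-- The map sending a partition to its `s`-core and its `s`-quotient. -/
def toCoreQuotient (hs : 0 < s) (p : IntPartition) : FlushPartition s × (Fin s → IntPartition) :=
  (⟨(coreQuotient s (betaSet p.2 (s * p.2.parts.card))).1, by
      have h := isFlush_flush hs (betaSet p.2 (s * p.2.parts.card))
      rwa [← betaSet_ofBetaSet (flush _ _), isFlush_betaSet_iff _ (card_parts_ofBetaSet_le _)] at h⟩,
    (coreQuotient s (betaSet p.2 (s * p.2.parts.card))).2)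

theorem toCoreQuotient_size (hs : 0 < s) (p : IntPartition) :
    (toCoreQuotient hs p).1.1.1 + s * ∑ r, ((toCoreQuotient hs p).2 r).1 = p.1 := by
  conv_rhs => rw [← ofBetaSet_betaSet p (Nat.le_mul_of_pos_left _ hs)]
  exact coreQuotient_size hs _

theorem toCoreQuotient_eq_iff (hs : 0 < s) (p : IntPartition)
    (x : FlushPartition s × (Fin s → IntPartition)) :
    toCoreQuotient hs p = x ↔
      coreQuotient s (betaSet p.2 (s * p.2.parts.card)) = (x.1.1, x.2) := by
  rw [Prod.ext_iff, Prod.ext_iff, Subtype.ext_iff]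
  rfl

theorem toCoreQuotient_injective (hs : 0 < s) : Function.Injective (toCoreQuotient hs) := by
  intro p q h
  have h' : coreQuotient s (betaSet p.2 (s * p.2.parts.card)) =
      coreQuotient s (betaSet q.2 (s * q.2.parts.card)) :=
    (toCoreQuotient_eq_iff hs p _).1 h
  -- A common number of beads for `p` and `q`, as `coreQuotient_injective` requires.
  have hp : p.2.parts.card ≤ s * (p.2.parts.card + q.2.parts.card) := by nlinarith
  have hq : q.2.parts.card ≤ s * (p.2.parts.card + q.2.parts.card) := by nlinarith
  rw [coreQuotient_betaSet_eq hs _ hp, coreQuotient_betaSet_eq hs _ hq] at h'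
  have h2 := coreQuotient_injective hs (by rw [card_betaSet, card_betaSet]) h'
  exact (ofBetaSet_betaSet p hp).symm.trans ((congrArg ofBetaSet h2).trans (ofBetaSet_betaSet q hq))

theorem le_card_runner_betaSet {n : ℕ} (p : n.Partition) {M : ℕ} (hM : p.parts.card ≤ s * M)
    (k : ℕ) (r : Fin s) : k ≤ (runner s r (betaSet p (s * (M + k)))).card := by
  induction k with
  | zero => exact Nat.zero_le _
  | succ k ih =>
    rw [← add_assoc, mul_add_one, runner_betaSet_add p (by nlinarith), card_bump]
    omega

theorem toCoreQuotient_surjective (hs : 0 < s) : Function.Surjective (toCoreQuotient hs) := by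
  rintro ⟨⟨κ, hκ⟩, μ⟩
  -- Padding the core with `s * b` extra beads puts at least `b` on each runner, enough to carry all
  -- the parts of `μ r`. Replacing each runner of `B` by the beta-set of `μ r` with equally many
  -- beads then gives the preimage.
  set b := ∑ r, (μ r).2.parts.card
  set M := κ.2.parts.card + b
  set B := betaSet κ.2 (s * M) with hB
  have hκ1 : κ.2.parts.card ≤ s * κ.2.parts.card := Nat.le_mul_of_pos_left _ hs
  have hκM : κ.2.parts.card ≤ s * M := hκ1.trans (Nat.mul_le_mul_left s (Nat.le_add_right _ _))
  have hBc : B.card = s * M := card_betaSet _ _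
  have hBf : flush s B = B := by
    apply IsFlush.flush_eq hs
    rwa [hB, isFlush_betaSet_iff _ hκM]
  have hμ : ∀ r, (μ r).2.parts.card ≤ (runner s r B).card := fun r =>
    (single_le_sum (f := fun r => (μ r).2.parts.card) (fun _ _ => Nat.zero_le _)
      (mem_univ r)).trans (le_card_runner_betaSet κ.2 hκ1 b r)
  let Z := ofRunners fun r : Fin s => betaSet (μ r).2 (runner s r B).card
  have hZr : ∀ r : Fin s, runner s r Z = betaSet (μ r).2 (runner s r B).card := runner_ofRunners _
  have hZf : flush s Z = B := by
    conv_rhs => rw [← hBf]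
    exact flush_congr fun r => by rw [hZr, card_betaSet]
  have hZc : Z.card = s * M := by rw [← card_flush hs, hZf, hBc]
  have hle := card_parts_ofBetaSet_le Z
  have hZ := betaSet_ofBetaSet Z
  rw [hZc] at hle hZ
  have hcq : coreQuotient s Z = (κ, μ) := by
    refine Prod.ext ?_ (funext fun r => ?_)
    · simp only [coreQuotient]
      rw [hZf, ofBetaSet_betaSet _ hκM]
    · simp only [coreQuotient]
      rw [hZr, ofBetaSet_betaSet _ (hμ r)]
  have h := coreQuotient_betaSet_eq hs _ hle
  rw [hZ, hcq] at h
  exact ⟨ofBetaSet Z, (toCoreQuotient_eq_iff hs _ _).2 h⟩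

end CoreTower

/-! ### Generating functions by weight -/

namespace CoreTower

open Finset PowerSeries
open scoped PowerSeries.WithPiTopology

section weight

variable {α β : Type*}

/-- The generating function of the elements of `α` by weight. -/
noncomputable def weightGF (w : α → ℕ) : ℚ⟦X⟧ :=
  PowerSeries.mk fun n => (Nat.card {a // w a = n} : ℚ)

theorem weightGF_eq_of_bijective {w : α → ℕ} {w' : β → ℕ} {f : α → β}
    (hf : Function.Bijective f) (h : ∀ a, w' (f a) = w a) : weightGF w = weightGF w' := by
  ext n
  simp only [weightGF, coeff_mk, Nat.cast_inj]
  exact Nat.card_congr ((Equiv.ofBijective f hf).subtypeEquiv fun a => by simp [h])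

/-- Pairs of total weight `n` sorted by the weights of the components. -/
def weightProdEquiv (w : α → ℕ) (w' : β → ℕ) (n : ℕ) :
    {x : α × β // w x.1 + w' x.2 = n} ≃
      Σ ij : antidiagonal n, {a // w a = ij.1.1} × {b // w' b = ij.1.2} where
  toFun x := ⟨⟨(w x.1.1, w' x.1.2), mem_antidiagonal.2 x.2⟩, ⟨x.1.1, rfl⟩, ⟨x.1.2, rfl⟩⟩
  invFun y := ⟨(y.2.1.1, y.2.2.1), by
    rw [y.2.1.2, y.2.2.2]
    exact mem_antidiagonal.1 y.1.2⟩
  left_inv _ := rfl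
  right_inv := by
    rintro ⟨⟨⟨i, j⟩, h⟩, ⟨a, ha⟩, ⟨b, hb⟩⟩
    obtain rfl : w a = i := ha
    obtain rfl : w' b = j := hb
    rfl

theorem finite_weight_prod {w : α → ℕ} {w' : β → ℕ} (hw : ∀ n, Finite {a // w a = n})
    (hw' : ∀ n, Finite {b // w' b = n}) (n : ℕ) :
    Finite {x : α × β // w x.1 + w' x.2 = n} :=
  Finite.of_equiv _ (weightProdEquiv w w' n).symm

theorem weightGF_prod {w : α → ℕ} {w' : β → ℕ} (hw : ∀ n, Finite {a // w a = n})
    (hw' : ∀ n, Finite {b // w' b = n}) :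
    weightGF (fun x : α × β => w x.1 + w' x.2) = weightGF w * weightGF w' := by
  ext n
  rw [coeff_mul]
  simp only [weightGF, coeff_mk]
  rw [Nat.card_congr (weightProdEquiv w w' n), Nat.card_sigma]
  simp only [Nat.card_prod]
  rw [← Finset.sum_coe_sort (antidiagonal n)]
  push_cast
  rfl

/-- Finiteness is carried through the induction because `weightGF_prod` needs it: `Nat.card` is 0 on
infinite types. -/
theorem weightGF_pi {w : α → ℕ} (hw : ∀ n, Finite {a // w a = n}) (s : ℕ) :
    (∀ n, Finite {f : Fin s → α // ∑ i, w (f i) = n}) ∧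
      weightGF (fun f : Fin s → α => ∑ i, w (f i)) = weightGF w ^ s := by
  induction s with
  | zero =>
    refine ⟨fun n => inferInstance, ?_⟩
    ext n
    simp only [weightGF, univ_eq_empty, sum_empty, coeff_mk, pow_zero, coeff_one]
    rcases n with _ | n
    · simp
    · simp
  | succ s ih =>
    have he : ∀ f : Fin (s + 1) → α, w ((Fin.consEquiv fun _ => α).symm f).1 +
        ∑ i, w (((Fin.consEquiv fun _ => α).symm f).2 i) = ∑ i, w (f i) := fun f => by
      rw [Fin.sum_univ_succ]
      rfl
    constructor
    · intro n
      have := finite_weight_prod hw ih.1 n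
      exact Finite.of_equiv _ ((Fin.consEquiv fun _ => α).symm.subtypeEquiv
        (q := fun x : α × (Fin s → α) => w x.1 + ∑ i, w (x.2 i) = n)
        fun f => by rw [he]).symm
    · rw [pow_succ', ← ih.2, ← weightGF_prod hw ih.1]
      exact weightGF_eq_of_bijective (Fin.consEquiv fun _ => α).symm.bijective he

theorem weightGF_mul {s : ℕ} (hs : s ≠ 0) (w : α → ℕ) :
    weightGF (fun a => s * w a) = expand s hs (weightGF w) := by
  ext n
  rw [coeff_expand]
  simp only [weightGF, coeff_mk]
  split_ifs with h
  · obtain ⟨m, rfl⟩ := h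
    rw [Nat.mul_div_cancel_left m (Nat.pos_of_ne_zero hs)]
    simp only [Nat.mul_right_inj hs]
  · have : IsEmpty {a // s * w a = n} := ⟨fun a => h ⟨_, a.2.symm⟩⟩
    simp

theorem finite_weight_mul {s : ℕ} (hs : s ≠ 0) {w : α → ℕ} (hw : ∀ n, Finite {a // w a = n})
    (n : ℕ) : Finite {a // s * w a = n} := by
  have := hw (n / s)
  refine Finite.of_injective
    (fun a : {a // s * w a = n} => (⟨a.1, ?_⟩ : {a // w a = n / s})) ?_
  · exact (Nat.div_eq_of_eq_mul_right (Nat.pos_of_ne_zero hs) a.2.symm).symm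
  · intro a b h
    exact Subtype.ext (congrArg (fun x => x.1) h)

end weight

/-! ### Euler's product and the count of flush partitions -/

theorem continuous_expand {s : ℕ} (hs : s ≠ 0) :
    Continuous (expand s hs : ℚ⟦X⟧ → ℚ⟦X⟧) := by
  rw [continuous_iff_continuousAt]
  intro f
  rw [ContinuousAt, WithPiTopology.tendsto_iff_coeff_tendsto]
  intro n
  simp only [coeff_expand]
  split_ifs
  · exact (WithPiTopology.continuous_coeff ℚ (n / s)).tendsto f
  · exact tendsto_const_nhds

theorem hasProd_qPochhammerInf {m : ℕ} (hm : 1 ≤ m) :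
    HasProd (fun k : ℕ => (1 - (X : ℚ⟦X⟧) ^ (m * (k + 1)))) (qPochhammerInf (X ^ m) (X ^ m)) := by
  have h := (multipliable_qPochhammerInf hm).hasProd
  refine Eq.mp ?_ h
  congr 1
  funext k
  rw [← pow_mul, ← pow_add, Nat.mul_succ, add_comm]

theorem expand_qPochhammerInf {s : ℕ} (hs : s ≠ 0) :
    expand s hs (qPochhammerInf X X) = qPochhammerInf (X ^ s) (X ^ s) := by
  have h := (hasProd_qPochhammerInf le_rfl).map (expand s hs) (continuous_expand hs)
  rw [pow_one] at h
  refine h.unique ?_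
  convert hasProd_qPochhammerInf (Nat.one_le_iff_ne_zero.2 hs) using 2 with k
  simp [pow_mul]

theorem weightGF_intPartition :
    weightGF (fun p : IntPartition => p.1) = Nat.Partition.genFun fun _ _ => (1 : ℚ) := by
  ext n
  rw [Nat.Partition.coeff_genFun, weightGF, coeff_mk, Nat.card_congr (Equiv.sigmaSubtype n)]
  simp [Finsupp.prod]

theorem weightGF_intPartition_mul :
    weightGF (fun p : IntPartition => p.1) * qPochhammerInf X X = 1 := by
  have h1 := Nat.Partition.hasProd_genFun fun _ _ => (1 : ℚ)
  have h2 := hasProd_qPochhammerInf le_rfl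
  rw [pow_one] at h2
  rw [weightGF_intPartition]
  refine (h1.mul h2).unique ?_
  convert hasProd_one with k
  -- Each factor is a geometric series in `X ^ (k + 1)` times `1 - X ^ (k + 1)`; `genFun` writes the
  -- constant term of the series separately.
  have h0 : constantCoeff ((X : ℚ⟦X⟧) ^ (k + 1)) = 0 := by simp
  have h3 := WithPiTopology.tsum_pow_mul_one_sub_of_constantCoeff_eq_zero h0
  rw [(WithPiTopology.summable_pow_of_constantCoeff_eq_zero h0).tsum_eq_zero_add] at h3
  simpa only [pow_zero, one_smul, one_mul, pow_mul] using h3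

theorem finite_intPartition (n : ℕ) : Finite {p : IntPartition // p.1 = n} :=
  Finite.of_equiv _ (Equiv.sigmaSubtype n).symm

theorem weightGF_flushPartition {s : ℕ} (hs : s ≠ 0) :
    weightGF (fun p : FlushPartition s => p.1.1) =
      qPochhammerInf (X ^ s) (X ^ s) ^ s * (qPochhammerInf X X)⁻¹ := by
  have hs' := Nat.pos_of_ne_zero hs
  have hpi := weightGF_pi finite_intPartition s
  have hfl : ∀ n, Finite {p : FlushPartition s // p.1.1 = n} := fun n => by
    have := finite_intPartition n
    exact Finite.of_injective
      (fun p : {p : FlushPartition s // p.1.1 = n} => (⟨p.1.1, p.2⟩ : {p : IntPartition // p.1 = n}))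
      fun a b h => Subtype.ext (Subtype.ext (congrArg (fun x => x.1) h))
  have h1 := weightGF_eq_of_bijective
    (w := fun p : IntPartition => p.1)
    (w' := fun x : FlushPartition s × (Fin s → IntPartition) => x.1.1.1 + s * ∑ r, (x.2 r).1)
    ⟨toCoreQuotient_injective hs', toCoreQuotient_surjective hs'⟩ (toCoreQuotient_size hs')
  rw [weightGF_prod (w := fun p : FlushPartition s => p.1.1)
    (w' := fun μ : Fin s → IntPartition => s * ∑ r, (μ r).1) hfl (finite_weight_mul hs hpi.1),
    weightGF_mul hs, hpi.2, map_pow] at h1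
  have h2 := weightGF_intPartition_mul
  have h3 := congrArg (expand s hs) h2
  rw [map_mul, expand_qPochhammerInf, map_one] at h3
  -- Needed for `⁻¹` to be a true inverse.
  have hc : constantCoeff (qPochhammerInf (X : ℚ⟦X⟧) X) ≠ 0 := by
    intro h0
    have := congrArg constantCoeff h2
    simp [h0] at this
  rw [PowerSeries.eq_mul_inv_iff_mul_eq hc]
  set E := expand s hs (weightGF fun p : IntPartition => p.1)
  set Q := qPochhammerInf (X : ℚ⟦X⟧) X
  set Qs := qPochhammerInf ((X : ℚ⟦X⟧) ^ s) (X ^ s)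
  set C := weightGF fun p : FlushPartition s => p.1.1
  -- `E * Qs = 1` is Euler's identity at q^s; inserting it exposes `C * E ^ s`, the generating
  -- function of all partitions.
  calc C * Q = C * Q * (E * Qs) ^ s := by rw [h3, one_pow, mul_one]
    _ = (C * E ^ s) * Q * Qs ^ s := by ring
    _ = Qs ^ s := by rw [← h1, h2, one_mul]

theorem mk_card_eq_of_iff_isFlush {s : ℕ} (hs : s ≠ 0) {P : ∀ n : ℕ, n.Partition → Prop}
    (hP : ∀ n p, P n p ↔ IsFlush s (betaSet p p.parts.card)) :
    PowerSeries.mk (fun n => (Nat.card {p : n.Partition // P n p} : ℚ)) =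
      qPochhammerInf (X ^ s) (X ^ s) ^ s * (qPochhammerInf X X)⁻¹ := by
  rw [← weightGF_flushPartition hs, weightGF]
  congr 1
  ext n
  rw [Nat.cast_inj]
  refine Nat.card_congr (Equiv.ofBijective
    (fun p => ⟨⟨⟨n, p.1⟩, (hP n p.1).1 p.2⟩, rfl⟩) ⟨?_, ?_⟩)
  · intro p q h
    have h' : (⟨n, p.1⟩ : IntPartition) = ⟨n, q.1⟩ := congrArg (fun x => x.1.1) h
    exact Subtype.ext (eq_of_heq (Sigma.mk.inj h').2)
  · rintro ⟨⟨⟨m, p⟩, hp⟩, h⟩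
    obtain rfl : m = n := h
    exact ⟨⟨p, (hP m p).2 hp⟩, rfl⟩

end CoreTower

theorem corollary1p4 (t : ℕ) (ht : 2 ≤ t) :
    (∀ j : ℕ,
      PowerSeries.mk (fun n => (CoreTower.numGeneralizedCores j t n : ℚ)) =
        CoreTower.qPochhammerInf (PowerSeries.X ^ t ^ (j + 1)) (PowerSeries.X ^ t ^ (j + 1))
            ^ t ^ (j + 1) *
          (CoreTower.qPochhammerInf PowerSeries.X PowerSeries.X)⁻¹) ∧
    (∀ (n : ℕ) (p : n.Partition), CoreTower.IsGeneralizedCore 0 t p ↔ CoreTower.IsTCore t p) ∧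
    PowerSeries.mk (fun n => (CoreTower.numTCores t n : ℚ)) =
      CoreTower.qPochhammerInf (PowerSeries.X ^ t) (PowerSeries.X ^ t) ^ t *
        (CoreTower.qPochhammerInf PowerSeries.X PowerSeries.X)⁻¹ := by
  have ht0 : 0 < t := by omega
  refine ⟨fun j => ?_, fun n p => ?_, ?_⟩
  · exact CoreTower.mk_card_eq_of_iff_isFlush (pow_pos ht0 _).ne'
      fun _ p => CoreTower.isGeneralizedCore_iff_isFlush ht0 j p
  · rw [CoreTower.isGeneralizedCore_iff_isFlush ht0, CoreTower.isTCore_iff_isFlush p ht0, zero_add,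
      pow_one]
  · exact CoreTower.mk_card_eq_of_iff_isFlush ht0.ne'
      fun _ p => CoreTower.isTCore_iff_isFlush p ht0
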